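/- Terminology. All graphs are finite and simple. For a vertex $x$ of a graph $G$, the unit sphere $S(x)$ is the subgraph induced by the neighbours of $x$, and $G-x$ is $G$ with the vertex $x$ removed. A graph is *contractible* if it is a one-point graph or, inductively, if it has a vertex $x$ such that both $S(x)$ and $G-x$ are contractible. A *homotopy reduction* replaces $G$ by $G-x$ for a vertex $x$ with $S(x)$ contractible; the reverse operation (adding a new vertex joined exactly to the vertices of a contractible induced subgraph) is a *homotopy extension*. Two graphs are *homotopic* if, up to isomorphism, finitely many homotopy reductions and extensions lead from one to the other. The empty graph is the $(-1)$-sphere, and for $d\ge 0$ a graph is a *$d$-sphere* if every unit sphere is a $(d-1)$-sphere and removing some vertex leaves a contractible graph. The *Whitney complex* of a graph is the simplicial complex of the vertex sets of its non-empty complete subgraphs. Theorem. For $n\ge 1$ let $G_n^+$ be the graph complement of the path graph on $n$ vertices. For every integer $d\ge 0$: 1. $G_{3d+1}^+$ is a contractible graph, and the geometric realization of its Whitney complex is a contractible topological space. 2. $G_{3d+2}^+$ and $G_{3d+3}^+$ are each homotopic, as graphs, to a $d$-sphere, and the geometric realization of the Whitney complex of each is homotopy equivalent to the standard sphere $\mathbb{S}^d=\{x\in\mathbb{R}^{d+1}:\|x\|=1\}$.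 -/

import Mathlib

open scoped ContinuousMap

namespace GraphHomotopy

/-- The unit sphere `S(x)` of a vertex `x`: the subgraph induced by the neighbours of `x`. -/
abbrev unitSphere {V : Type} (G : SimpleGraph V) (x : V) : SimpleGraph (G.neighborSet x) :=
  G.induce (G.neighborSet x)

/-- The graph `G - x` obtained by removing the vertex `x`. -/
abbrev removeVertex {V : Type} (G : SimpleGraph V) (x : V) : SimpleGraph ({x}ᶜ : Set V) :=
  G.induce {x}ᶜ

/-- Contractible graphs: a graph is contractible if it can be reduced to a one-point graph by
successively removing vertices whose unit spheres are contractible. (Such a graph is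
automatically finite and non-empty.) -/
inductive Contractible : {V : Type} → SimpleGraph V → Prop
  | point {V : Type} (G : SimpleGraph V) (x : V) (h : ∀ y, y = x) : Contractible G
  | reduce {V : Type} (G : SimpleGraph V) (x : V) (hS : Contractible (unitSphere G x))
      (hG : Contractible (removeVertex G x)) : Contractible G

/-- Homotopic graphs: finitely many homotopy reductions (removal of a vertex whose unit sphere is
contractible) and their reverse operations, the homotopy extensions (adding a new vertex, joined
to all vertices of a contractible subgraph), lead from one graph to the other, up to isomorphism.
All graphs linked to a finite graph in this way are finite. -/
inductive Homotopic : {V W : Type} → SimpleGraph V → SimpleGraph W → Prop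
  | iso {V W : Type} {G : SimpleGraph V} {H : SimpleGraph W} (e : G ≃g H) : Homotopic G H
  | reduction {V : Type} (G : SimpleGraph V) (x : V) (hS : Contractible (unitSphere G x)) :
      Homotopic G (removeVertex G x)
  | symm {V W : Type} {G : SimpleGraph V} {H : SimpleGraph W} (h : Homotopic G H) :
      Homotopic H G
  | trans {U V W : Type} {F : SimpleGraph U} {G : SimpleGraph V} {H : SimpleGraph W}
      (h₁ : Homotopic F G) (h₂ : Homotopic G H) : Homotopic F H

/-- Discrete `d`-spheres: every unit sphere is a `(d-1)`-sphere (the `(-1)`-sphere being the empty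
graph), and removing some vertex leaves a contractible graph. -/
def IsSphere : ℕ → {V : Type} → SimpleGraph V → Prop
  | 0, V, G => (∀ x : V, IsEmpty (G.neighborSet x)) ∧ ∃ x : V, Contractible (removeVertex G x)
  | d + 1, V, G => (∀ x : V, IsSphere d (unitSphere G x)) ∧
      ∃ x : V, Contractible (removeVertex G x)

/-- `G` is homotopic, as a graph, to some discrete `d`-sphere. -/
def IsHomotopySphere (d : ℕ) {V : Type} (G : SimpleGraph V) : Prop :=
  ∃ (W : Type) (H : SimpleGraph W), IsSphere d H ∧ Homotopic G H

/-- The geometric realization of the Whitney (clique) complex of a finite graph: the points of the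
standard simplex on the vertices, given by barycentric coordinates, whose support is a clique.
It carries the subspace topology of `V → ℝ`. -/
def whitneyRealization {V : Type} [Fintype V] (G : SimpleGraph V) : Set (V → ℝ) :=
  {p | p ∈ stdSimplex ℝ V ∧ G.IsClique (Function.support p)}

/-- The graph complement of the path graph on `n` vertices. -/
abbrev pathComplement (n : ℕ) : SimpleGraph (Fin n) :=
  (SimpleGraph.pathGraph n)ᶜ

end GraphHomotopy

namespace GraphHomotopy

/-! Labels are adjacent in the path complement iff they differ by at least 2. If every neighbour of
`x` other than its neighbour `y` is adjacent to `y`, then `S(x)` is a cone with apex `y`, so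
removing `x` is a homotopy reduction, and folding `x` onto `y` is a homotopy equivalence of
realizations. Taken in increasing order, the labels `m ≡ 2 (mod 3)` are dominated by `m - 2` and can
all be removed (`exists_fold`). What survives are the labels `3i` and `3i + 1`, where non-adjacency
only matches `3i` with `3i + 1`. If all pairs are complete this is a cross polytope, a sphere in
both senses; if `3d` has lost its partner, it is the apex of a cone. -/

/-! ### Cones, dominated vertices and discrete cross polytopes -/

theorem contractible_of_cone : ∀ (n : ℕ) {V : Type} [Finite V] (G : SimpleGraph V) (a : V),
    Nat.card V = n → (∀ v, v ≠ a → G.Adj v a) → Contractible G := by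
  intro n
  induction n using Nat.strong_induction_on with
  | _ n ih =>
    intro V _ G a hn ha
    by_cases h : ∀ y, y = a
    · exact .point G a h
    · push Not at h
      obtain ⟨x, hx⟩ := h
      -- `S(x)` and `G - x` are both smaller cones with apex `a`.
      refine .reduce G x ?_ ?_
      · refine ih _ ?_ (unitSphere G x) ⟨a, ha x hx⟩ rfl ?_
        · rw [← hn]
          exact Finite.card_subtype_lt (x := x) (by simp)
        · intro v hv
          exact ha v.1 fun h => hv (Subtype.ext h)
      · refine ih _ ?_ (removeVertex G x) ⟨a, by simpa using hx.symm⟩ rfl ?_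
        · rw [← hn]
          exact Finite.card_subtype_lt (x := x) (by simp)
        · intro v hv
          exact ha v.1 fun h => hv (Subtype.ext h)

/-- A vertex dominated by one of its neighbours has a contractible unit sphere. -/
theorem contractible_unitSphere_of_dominated {V : Type} [Finite V] {G : SimpleGraph V} {x y : V}
    (hxy : G.Adj x y) (h : ∀ z, G.Adj x z → z = y ∨ G.Adj z y) :
    Contractible (unitSphere G x) :=
  contractible_of_cone _ _ ⟨y, hxy⟩ rfl fun v hv =>
    (h v.1 v.2).resolve_left fun e => hv (Subtype.ext e)

/-- A graph whose non-adjacent pairs are matched by a fixed-point free involution is a sphere. -/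
theorem isSphere_of_involution : ∀ (d : ℕ) {V : Type} [Finite V] (G : SimpleGraph V) (σ : V → V),
    Nat.card V = 2 * (d + 1) → (∀ v, σ (σ v) = v) → (∀ v, σ v ≠ v) →
    (∀ u v, G.Adj u v ↔ v ≠ u ∧ v ≠ σ u) → IsSphere d G := by
  have key : ∀ {V : Type} [Finite V] (G : SimpleGraph V) (σ : V → V),
      Nat.card V ≠ 0 → (∀ v, σ (σ v) = v) → (∀ v, σ v ≠ v) →
      (∀ u v, G.Adj u v ↔ v ≠ u ∧ v ≠ σ u) → ∃ x : V, Contractible (removeVertex G x) := by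
    intro V _ G σ hc hσ hσ' hG
    obtain ⟨⟨x⟩, _⟩ := Nat.card_ne_zero.1 hc
    -- The only non-neighbour of `σ x` besides itself is `x`, so `G - x` is a cone.
    refine ⟨x, contractible_of_cone _ _ ⟨σ x, by simpa using hσ' x⟩ rfl fun v hv => ?_⟩
    refine (hG _ _).2 ⟨fun h => hv (Subtype.ext h.symm), fun h => v.2 ?_⟩
    have h' : σ (σ x) = σ (σ v.1) := congrArg σ h
    rw [hσ, hσ] at h'
    exact h'.symm
  have hcard : ∀ {V : Type} [Finite V] (G : SimpleGraph V) (σ : V → V),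
      (∀ v, σ v ≠ v) → (∀ u v, G.Adj u v ↔ v ≠ u ∧ v ≠ σ u) → ∀ x,
      Nat.card (G.neighborSet x) + 2 = Nat.card V := by
    intro V _ G σ hσ' hG x
    have h : G.neighborSet x = ({x, σ x} : Set V)ᶜ := by
      ext v; simp [hG]
    have h2 : ({x, σ x} : Set V).ncard = 2 := Set.ncard_pair (hσ' x).symm
    rw [h, Nat.card_coe_set_eq, ← h2, add_comm]
    exact Set.ncard_add_ncard_compl _
  intro d
  induction d with
  | zero =>
    intro V _ G σ hc hσ hσ' hG
    refine ⟨fun x => ?_, key G σ (by omega) hσ hσ' hG⟩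
    have := hcard G σ hσ' hG x
    exact Finite.card_eq_zero_iff.1 (by omega)
  | succ d ih =>
    intro V _ G σ hc hσ hσ' hG
    refine ⟨fun x => ?_, key G σ (by omega) hσ hσ' hG⟩
    have hx := hcard G σ hσ' hG x
    -- `σ` preserves the complement of `{x, σ x}`, so it restricts to `S(x)`.
    have hm : ∀ v : G.neighborSet x, σ v.1 ∈ G.neighborSet x := by
      rintro ⟨v, hv⟩
      obtain ⟨h1, h2⟩ := (hG _ _).1 hv
      refine (hG _ _).2 ⟨fun h => h2 ?_, fun h => h1 ?_⟩
      · rw [← h, hσ]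
      · have := congrArg σ h
        simpa only [hσ] using this
    refine ih (unitSphere G x) (fun v => ⟨σ v.1, hm v⟩) (by omega) (fun v => Subtype.ext (hσ _))
      (fun v h => hσ' _ (congrArg Subtype.val h)) fun u v => ?_
    simp [hG, Subtype.ext_iff]

/-! ### Homotopies of Whitney realizations -/

/-- Maps into the realization that are pointwise contained in a common simplex are homotopic. -/
theorem homotopic_of_isClique_union {X V : Type} [TopologicalSpace X] [Fintype V]
    {G : SimpleGraph V} (f g : C(X, whitneyRealization G))
    (h : ∀ x, G.IsClique (Function.support (f x).1 ∪ Function.support (g x).1)) :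
    f.Homotopic g := by
  -- The straight-line homotopy stays in the common simplex.
  refine ⟨⟨⟨fun q => ⟨(1 - q.1.1) • (f q.2).1 + q.1.1 • (g q.2).1, ?_, ?_⟩, ?_⟩, ?_, ?_⟩⟩
  · exact convex_stdSimplex ℝ V (f q.2).2.1 (g q.2).2.1 (sub_nonneg.2 q.1.2.2) q.1.2.1 (by ring)
  · refine (h q.2).subset fun v hv => ?_
    by_contra hn
    simp only [Set.mem_union, Function.mem_support, not_or, not_not] at hn
    exact hv (by simp [hn.1, hn.2])
  · fun_prop
  · intro x; ext; simp
  · intro x; ext; simp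

theorem isClique_union_of_dominated {V : Type} {G : SimpleGraph V} {x y : V}
    (hxy : G.Adj x y) (h : ∀ z, G.Adj x z → z = y ∨ G.Adj z y) {s : Set V} (hs : G.IsClique s) (hx : x ∈ s) :
    G.IsClique (insert y s) := by
  refine hs.insert fun z hz hyz => ?_
  by_cases hzx : x = z
  · exact hzx ▸ hxy.symm
  · exact ((h z (hs hx hz hzx)).resolve_left hyz.symm).symm

/-- The map of realizations induced by a map of vertices sending cliques to cliques. -/
noncomputable def realizationMap {V W : Type} [Fintype V] [Fintype W] {G : SimpleGraph V}
    {H : SimpleGraph W} (f : V → W) (hf : ∀ s, G.IsClique s → H.IsClique (f '' s)) :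
    C(whitneyRealization G, whitneyRealization H) where
  toFun p := ⟨FunOnFinite.linearMap ℝ ℝ f p.1, stdSimplex.image_linearMap f ⟨p.1, p.2.1, rfl⟩,
    (hf _ p.2.2).subset (by
      classical
      intro w hw
      rw [Function.mem_support, FunOnFinite.linearMap_apply_apply] at hw
      obtain ⟨v, hv, hv'⟩ := Finset.exists_ne_zero_of_sum_ne_zero hw
      exact ⟨v, hv', (Finset.mem_filter.1 hv).2⟩)⟩
  continuous_toFun := by
    have := FunOnFinite.continuous_linearMap ℝ ℝ f
    fun_prop

theorem support_realizationMap_subset {V W : Type} [Fintype V] [Fintype W] {G : SimpleGraph V}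
    {H : SimpleGraph W} (f : V → W) (hf : ∀ s, G.IsClique s → H.IsClique (f '' s))
    (p : whitneyRealization G) :
    Function.support (realizationMap f hf p).1 ⊆ f '' Function.support p.1 := by
  classical
  intro w hw
  change FunOnFinite.linearMap ℝ ℝ f p.1 w ≠ 0 at hw
  rw [FunOnFinite.linearMap_apply_apply] at hw
  obtain ⟨v, hv, hv'⟩ := Finset.exists_ne_zero_of_sum_ne_zero hw
  exact ⟨v, hv', (Finset.mem_filter.1 hv).2⟩

/-- Removing a dominated vertex does not change the homotopy type of the realization. -/
theorem nonempty_homotopyEquiv_removeVertex {V : Type} [Fintype V] {G : SimpleGraph V} {x y : V}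
    [Fintype ({x}ᶜ : Set V)] (hxy : G.Adj x y) (h : ∀ z, G.Adj x z → z = y ∨ G.Adj z y) :
    Nonempty (whitneyRealization G ≃ₕ whitneyRealization (removeVertex G x)) := by
  classical
  let r : V → ({x}ᶜ : Set V) := fun v => if hv : v = x then ⟨y, hxy.ne'⟩ else ⟨v, hv⟩
  have hr : ∀ v, (r v).1 = if v = x then y else v := fun v => by
    simp only [r]; split_ifs <;> rfl
  -- A clique and its folded image span a clique: this makes `r` simplicial and also yields the
  -- homotopy to the identity.
  have hclique : ∀ s, G.IsClique s → G.IsClique (s ∪ (fun v => (r v).1) '' s) := fun s hs => by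
    by_cases hx : x ∈ s
    · refine (isClique_union_of_dominated hxy h hs hx).subset (Set.union_subset ?_ ?_)
      · exact Set.subset_insert _ _
      · rintro _ ⟨v, hv, rfl⟩
        simp only [hr]
        split_ifs
        · exact Set.mem_insert _ _
        · exact Set.mem_insert_of_mem _ hv
    · refine hs.subset (Set.union_subset le_rfl ?_)
      rintro _ ⟨v, hv, rfl⟩
      have : v ≠ x := fun e => hx (e ▸ hv)
      simpa [hr, this] using hv
  have hR : ∀ s, G.IsClique s → (removeVertex G x).IsClique (r '' s) := by
    rintro s hs _ ⟨a, ha, rfl⟩ _ ⟨b, hb, rfl⟩ hab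
    exact hclique s hs (Or.inr ⟨a, ha, rfl⟩) (Or.inr ⟨b, hb, rfl⟩) fun e => hab (Subtype.ext e)
  have hI : ∀ s, (removeVertex G x).IsClique s → G.IsClique (Subtype.val '' s) := by
    rintro s hs _ ⟨a, ha, rfl⟩ _ ⟨b, hb, rfl⟩ hab
    exact hs ha hb fun e => hab (congrArg _ e)
  refine ⟨⟨realizationMap r hR, realizationMap Subtype.val hI, ?_, ?_⟩⟩
  · refine (homotopic_of_isClique_union _ _ fun p => ?_).symm
    refine (hclique _ p.2.2).subset (Set.union_subset_union_right _ ?_)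
    refine (support_realizationMap_subset _ hI _).trans ?_
    rw [← Set.image_image Subtype.val r]
    exact Set.image_mono (support_realizationMap_subset _ hR p)
  -- This composite equals the identity, since `r` fixes all vertices other than `x`.
  · convert ContinuousMap.Homotopic.refl _
    ext p : 2
    have hrv : r ∘ Subtype.val = id := by
      ext v
      have : v.1 ≠ x := v.2
      simp [hr, this]
    have := stdSimplex.map_comp_apply Subtype.val r (⟨p.1, p.2.1⟩ : stdSimplex ℝ ({x}ᶜ : Set V))
    rw [hrv, stdSimplex.map_id_apply] at this
    exact (congrArg Subtype.val this).symm

/-- Adding `a` to a clique leaves a clique, so segments to the vertex `a` contract the realization.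
-/
theorem contractibleSpace_whitneyRealization_of_cone {V : Type} [Fintype V] (G : SimpleGraph V)
    (a : V) (ha : ∀ v, v ≠ a → G.Adj v a) : ContractibleSpace (whitneyRealization G) := by
  classical
  rw [contractible_iff_id_nullhomotopic]
  refine ⟨⟨Pi.single a 1, single_mem_stdSimplex ℝ a, ?_⟩, homotopic_of_isClique_union _ _ ?_⟩
  · exact (Set.pairwise_singleton a _).mono (Pi.support_single_subset)
  · intro p
    refine (p.2.2.insert (a := a) fun v _ hv => (ha v hv.symm).symm).subset ?_
    refine Set.union_subset (Set.subset_insert _ _) ?_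
    exact Pi.support_single_subset.trans (by simp)

/-! ### The cross polytope and the Euclidean sphere -/

/-- The point of the cross polytope on a ray, in barycentric coordinates. -/
noncomputable def crossPolytopeCoord {ι : Type} [Fintype ι] (v : ι → ℝ) (i : ι × Bool) : ℝ :=
  max 0 (if i.2 then v i.1 else -v i.1) / ∑ j, |v j|

theorem sum_crossPolytopeCoord {ι : Type} [Fintype ι] {v : ι → ℝ} (hv : v ≠ 0) :
    ∑ i, crossPolytopeCoord v i = 1 := by
  have h0 : ∑ j, |v j| ≠ 0 := fun h => hv <| funext fun j => by
    simpa using (Finset.sum_eq_zero_iff_of_nonneg fun j _ => abs_nonneg (v j)).1 h j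
      (Finset.mem_univ j)
  simp only [crossPolytopeCoord]
  rw [← Finset.sum_div, Fintype.sum_prod_type, div_eq_one_iff_eq h0]
  refine Finset.sum_congr rfl fun j _ => ?_
  simp only [Fintype.sum_bool]
  rcases le_total 0 (v j) with h | h
  · simp [h, abs_of_nonneg]
  · simp [h, abs_of_nonpos]

/-- The coordinates depend only on the ray, so they undo the Euclidean normalization in the
homeomorphism below. -/
theorem crossPolytopeCoord_smul {ι : Type} [Fintype ι] {c : ℝ} (hc : 0 < c) (v : ι → ℝ) :
    crossPolytopeCoord (c • v) = crossPolytopeCoord v := by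
  ext ⟨i, b⟩
  have h : ∀ a : ℝ, max 0 (c * a) = c * max 0 a := fun a => by
    rw [mul_max_of_nonneg _ _ hc.le, mul_zero]
  have h' : (if b then c * v i else -(c * v i)) = c * (if b then v i else -v i) := by
    split_ifs <;> ring
  simp only [crossPolytopeCoord, Pi.smul_apply, smul_eq_mul, abs_mul, abs_of_pos hc,
    ← Finset.mul_sum, h', h]
  exact mul_div_mul_left _ _ hc.ne'

/-- The coordinates determined by signed differences recover a point of the simplex supported
on a face of the cross polytope. -/
theorem crossPolytopeCoord_sub {ι : Type} [Fintype ι] {q : ι × Bool → ℝ}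
    (hq : q ∈ stdSimplex ℝ (ι × Bool)) (h : ∀ i, q (i, true) = 0 ∨ q (i, false) = 0) :
    crossPolytopeCoord (fun i => q (i, true) - q (i, false)) = q := by
  have hs : ∑ j, |q (j, true) - q (j, false)| = 1 := by
    rw [← hq.2, Fintype.sum_prod_type]
    refine Finset.sum_congr rfl fun j _ => ?_
    have h1 := hq.1 (j, true)
    have h2 := hq.1 (j, false)
    rcases h j with h | h <;> simp [h, abs_of_nonneg, h1, h2]
  ext ⟨i, b⟩
  have h1 := hq.1 (i, true)
  have h2 := hq.1 (i, false)
  rcases h i with h | h <;> cases b <;> simp [crossPolytopeCoord, hs, h, h1, h2]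

theorem crossPolytopeCoord_true_sub_false {ι : Type} [Fintype ι] (v : ι → ℝ) (i : ι) :
    crossPolytopeCoord v (i, true) - crossPolytopeCoord v (i, false) = (∑ j, |v j|)⁻¹ * v i := by
  simp only [crossPolytopeCoord, div_eq_inv_mul]
  rcases le_total 0 (v i) with h | h <;> simp [h]

/-- The realization of the graph of a cross polytope is homeomorphic to a sphere. -/
noncomputable def whitneyRealizationHomeomorphSphere {ι V : Type} [Fintype ι] [Fintype V]
    (G : SimpleGraph V) (e : V ≃ ι × Bool) (hG : ∀ u v, G.Adj u v ↔ (e u).1 ≠ (e v).1) :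
    whitneyRealization G ≃ₜ Metric.sphere (0 : EuclideanSpace ℝ ι) 1 := by
  have hq : ∀ p : whitneyRealization G, p.1 ∘ e.symm ∈ stdSimplex ℝ (ι × Bool) := fun p =>
    ⟨fun i => p.2.1.1 _, by rw [← p.2.1.2]; exact Equiv.sum_comp e.symm p.1⟩
  have hq' : ∀ (p : whitneyRealization G) (i : ι),
      (p.1 ∘ e.symm) (i, true) = 0 ∨ (p.1 ∘ e.symm) (i, false) = 0 := fun p i => by
    by_contra! h
    have := p.2.2 (Function.mem_support.2 h.1) (Function.mem_support.2 h.2) (by simp)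
    simp [hG] at this
  let D : whitneyRealization G → EuclideanSpace ℝ ι := fun p =>
    WithLp.toLp 2 fun i => (p.1 ∘ e.symm) (i, true) - (p.1 ∘ e.symm) (i, false)
  have hDc : Continuous D := by
    refine (PiLp.continuous_toLp 2 _).comp (continuous_pi fun i => ?_)
    exact ((continuous_apply _).comp continuous_subtype_val).sub
      ((continuous_apply _).comp continuous_subtype_val)
  have hD : ∀ p, crossPolytopeCoord (D p).ofLp = p.1 ∘ e.symm := fun p =>
    crossPolytopeCoord_sub (hq p) (hq' p)
  have hD0 : ∀ p, D p ≠ 0 := fun p h => by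
    have h1 := hD p
    have h2 := (hq p).2
    rw [← h1, h] at h2
    -- At `0` every coordinate is `0 / 0 = 0`, so they cannot sum to 1.
    simp [crossPolytopeCoord] at h2
  have hS : ∀ v : Metric.sphere (0 : EuclideanSpace ℝ ι) 1, v.1.ofLp ≠ 0 := fun v h => by
    have : v.1 = 0 := by ext i; simp [h]
    simpa [this] using v.2
  have hpos : ∀ v : Metric.sphere (0 : EuclideanSpace ℝ ι) 1, 0 < ∑ j, |v.1 j| := fun v => by
    refine lt_of_le_of_ne (by positivity) fun h => hS v <| funext fun j => ?_
    simpa using (Finset.sum_eq_zero_iff_of_nonneg fun j _ => abs_nonneg (v.1 j)).1 h.symm j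
      (Finset.mem_univ j)
  refine
    { toFun := fun p => ⟨‖D p‖⁻¹ • D p, ?_⟩
      invFun := fun v => ⟨crossPolytopeCoord v.1.ofLp ∘ e, ⟨fun w => ?_, ?_⟩, ?_⟩
      left_inv := fun p => ?_
      right_inv := fun v => ?_
      continuous_toFun := ?_
      continuous_invFun := ?_ }
  · simp [norm_smul, hD0]
  · exact div_nonneg (le_max_left _ _) (Finset.sum_nonneg fun _ _ => abs_nonneg _)
  · exact (Equiv.sum_comp e _).trans (sum_crossPolytopeCoord (hS v))
  · intro a ha b hb hab
    refine (hG a b).2 fun h => hab (e.injective (Prod.ext h ?_))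
    simp only [Function.mem_support, Function.comp, crossPolytopeCoord, h, ne_eq, div_eq_zero_iff,
      not_or] at ha hb
    -- Opposite vertices carry the positive and negative parts of one real number, which are not
    -- both nonzero.
    by_contra hne
    rcases le_total 0 (v.1.ofLp (e b).1) with h0 | h0 <;> cases ha2 : (e a).2 <;>
      cases hb2 : (e b).2 <;> simp_all
  · refine Subtype.ext ?_
    have h1 := crossPolytopeCoord_smul (inv_pos.2 (norm_pos_iff.2 (hD0 p))) (D p).ofLp
    rw [hD] at h1
    change crossPolytopeCoord (‖D p‖⁻¹ • (D p).ofLp) ∘ e = p.1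
    rw [h1, Function.comp_assoc]
    simp
  · refine Subtype.ext ?_
    have key : ∀ p, D p = (∑ j, |v.1 j|)⁻¹ • v.1 →
        ‖D p‖⁻¹ • D p = v.1 := fun p h => by
      have hv : ‖v.1‖ = 1 := by simp
      rw [h, norm_smul, hv, mul_one, Real.norm_of_nonneg (inv_pos.2 (hpos v)).le, inv_inv,
        smul_smul, mul_inv_cancel₀ (hpos v).ne', one_smul]
    refine key _ ?_
    ext i
    simp [D, crossPolytopeCoord_true_sub_false]
  · exact Continuous.subtype_mk ((hDc.norm.inv₀ fun p => norm_ne_zero_iff.2 (hD0 p)).smul hDc) _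
  · refine Continuous.subtype_mk (continuous_pi fun w => ?_) _
    simp only [Function.comp, crossPolytopeCoord]
    refine Continuous.div ?_ (by fun_prop) fun v => (hpos v).ne'
    split_ifs <;> fun_prop

/-! ### Folding the path complement -/

/-- If the vertices are labelled by `f` so that non-adjacency means that labels are at distance at
most one, then all vertices with label congruent to `2` modulo `3` can be folded away. -/
theorem exists_fold (n : ℕ) : ∀ (k : ℕ) {V : Type} [Fintype V] (G : SimpleGraph V) (f : V → ℕ),
    Nat.card V = k → f.Injective → (∀ v, f v < n) → (∀ u < n, u % 3 ≠ 2 → ∃ v, f v = u) →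
    (∀ u v, G.Adj u v ↔ f u + 1 < f v ∨ f v + 1 < f u) →
    ∃ (W : Type) (_ : Fintype W) (H : SimpleGraph W) (g : W → ℕ),
      g.Injective ∧ (∀ u, (∃ v, g v = u) ↔ u < n ∧ u % 3 ≠ 2) ∧
      (∀ u v, H.Adj u v ↔ g u + 1 < g v ∨ g v + 1 < g u) ∧
      (Contractible H → Contractible G) ∧ Homotopic G H ∧
      Nonempty (whitneyRealization G ≃ₕ whitneyRealization H) := by
  intro k
  induction k using Nat.strong_induction_on with
  | _ k ih =>
    intro V _ G f hk hf hlt hsurj hG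
    -- The label is quantified first so that `Nat.find` gives the least one congruent to 2.
    by_cases hx : ∃ m x, f x = m ∧ m % 3 = 2
    · classical
      obtain ⟨x, hxm, hm⟩ := Nat.find_spec hx
      have hmin := fun j (hj : j < Nat.find hx) => Nat.find_min hx hj
      generalize Nat.find hx = m at hxm hm hmin
      subst hxm
      obtain ⟨y, hy⟩ := hsurj (f x - 2) (by have := hlt x; omega) (by omega)
      have hxy : G.Adj x y := (hG _ _).2 (by omega)
      have hdom : ∀ z, G.Adj x z → z = y ∨ G.Adj z y := fun z hz => by
        rw [hG] at hz ⊢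
        by_cases hzy : f z = f y
        · exact Or.inl (hf hzy)
        · have h3 : f z + 3 ≠ f x := fun h => hmin (f z) (by omega) ⟨z, rfl, by omega⟩
          omega
      have hS := contractible_unitSphere_of_dominated hxy hdom
      obtain ⟨e⟩ := nonempty_homotopyEquiv_removeVertex hxy hdom
      obtain ⟨W, _, H, g, hg, hgr, hH, hc, hh, ⟨e'⟩⟩ := ih _
        (by rw [← hk]; exact Finite.card_subtype_lt (x := x) (by simp))
        (removeVertex G x) (fun v => f v.1) rfl (fun a b h => Subtype.ext (hf h))
        (fun v => hlt _) (fun u hu hu2 => by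
          obtain ⟨v, rfl⟩ := hsurj u hu hu2
          exact ⟨⟨v, fun h => hu2 (by rw [Set.mem_singleton_iff.1 h]; exact hm)⟩, rfl⟩)
        (fun u v => hG _ _)
      exact ⟨W, _, H, g, hg, hgr, hH, fun h => .reduce G x hS (hc h),
        (Homotopic.reduction G x hS).trans hh, ⟨e.trans e'⟩⟩
    · push Not at hx
      refine ⟨V, _, G, f, hf, fun u => ⟨?_, fun h => hsurj u h.1 h.2⟩, hG, id, .iso .refl,
        ⟨.refl _⟩⟩
      rintro ⟨v, rfl⟩
      exact ⟨hlt v, hx _ v rfl⟩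

theorem exists_fold_pathComplement (n : ℕ) :
    ∃ (W : Type) (_ : Fintype W) (H : SimpleGraph W) (g : W → ℕ),
      g.Injective ∧ (∀ u, (∃ v, g v = u) ↔ u < n ∧ u % 3 ≠ 2) ∧
      (∀ u v, H.Adj u v ↔ g u + 1 < g v ∨ g v + 1 < g u) ∧
      (Contractible H → Contractible (pathComplement n)) ∧ Homotopic (pathComplement n) H ∧
      Nonempty (whitneyRealization (pathComplement n) ≃ₕ whitneyRealization H) := by
  refine exists_fold n _ (pathComplement n) Fin.val rfl Fin.val_injective (fun v => v.2)
    (fun u hu _ => ⟨⟨u, hu⟩, rfl⟩) fun u v => ?_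
  rw [SimpleGraph.compl_adj, SimpleGraph.pathGraph_adj, Ne, Fin.ext_iff]
  omega

/-- In both cases the surviving labels are the `d + 1` pairs `3i`, `3i + 1` with `i ≤ d`, since `3d
+ 2` is folded away. -/
theorem isHomotopySphere_pathComplement (d n : ℕ) (hn : n = 3 * d + 2 ∨ n = 3 * d + 3) :
    IsHomotopySphere d (pathComplement n) ∧
      Nonempty (whitneyRealization (pathComplement n) ≃ₕ
        Metric.sphere (0 : EuclideanSpace ℝ (Fin (d + 1))) 1) := by
  obtain ⟨W, _, H, g, hg, hgr, hH, -, hh, ⟨e⟩⟩ := exists_fold_pathComplement n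
  have hlt : ∀ w, g w < n ∧ g w % 3 ≠ 2 := fun w => (hgr _).1 ⟨w, rfl⟩
  let F : W → Fin (d + 1) × Bool := fun w =>
    (⟨g w / 3, by have := hlt w; omega⟩, decide (g w % 3 = 0))
  have hF : F.Bijective := by
    constructor
    · intro a b hab
      simp only [F, Prod.mk.injEq, Fin.mk.injEq, decide_eq_decide] at hab
      have := hlt a
      have := hlt b
      exact hg (by omega)
    · rintro ⟨⟨i, hi⟩, b⟩
      obtain ⟨w, hw⟩ := (hgr (3 * i + if b then 0 else 1)).2 (by cases b <;> simp <;> omega)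
      refine ⟨w, ?_⟩
      cases b <;> simp at hw <;> simp [F, hw] <;> omega
  let E := Equiv.ofBijective F hF
  have hE : ∀ u v, H.Adj u v ↔ (E u).1 ≠ (E v).1 := fun u v => by
    have := hlt u
    have := hlt v
    simp only [hH, E, F, Equiv.ofBijective_apply, ne_eq, Fin.mk.injEq]
    omega
  refine ⟨⟨W, H, ?_, hh⟩, ⟨e.trans (whitneyRealizationHomeomorphSphere H E hE).toHomotopyEquiv⟩⟩
  -- The antipode exchanges `3i` and `3i + 1`.
  refine isSphere_of_involution d H (fun w => E.symm ((E w).1, !(E w).2)) ?_ (by simp) ?_ ?_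
  · rw [Nat.card_congr E, Nat.card_eq_fintype_card]
    simp
    ring
  · intro v
    rw [Ne, Equiv.symm_apply_eq, Prod.ext_iff]
    simp
  · intro u v
    rw [hE, Ne, Ne, Ne, Equiv.eq_symm_apply, ← E.injective.eq_iff, Prod.ext_iff, Prod.ext_iff]
    cases (E u).2 <;> cases (E v).2 <;> simp [eq_comm]

theorem contractible_pathComplement (d : ℕ) :
    Contractible (pathComplement (3 * d + 1)) ∧
      ContractibleSpace (whitneyRealization (pathComplement (3 * d + 1))) := by
  obtain ⟨W, _, H, g, hg, hgr, hH, hc, -, ⟨e⟩⟩ := exists_fold_pathComplement (3 * d + 1)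
  -- The neighbouring labels of `3d` are missing: `3d - 1` is folded away and `3d + 1` is out of
  -- range.
  obtain ⟨a, ha⟩ := (hgr (3 * d)).2 (by omega)
  have hcone : ∀ v, v ≠ a → H.Adj v a := fun v hv => by
    have h1 := (hgr (g v)).1 ⟨v, rfl⟩
    have h2 : g v ≠ g a := fun h => hv (hg h)
    rw [hH]
    omega
  have := contractibleSpace_whitneyRealization_of_cone H a hcone
  exact ⟨hc (contractible_of_cone _ H a rfl hcone), e.contractibleSpace⟩

end GraphHomotopy

theorem mainTheorem2 (d : ℕ) :
    (GraphHomotopy.Contractible (GraphHomotopy.pathComplement (3 * d + 1)) ∧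
      ContractibleSpace
        (GraphHomotopy.whitneyRealization (GraphHomotopy.pathComplement (3 * d + 1)))) ∧
    (GraphHomotopy.IsHomotopySphere d (GraphHomotopy.pathComplement (3 * d + 2)) ∧
      Nonempty
        (GraphHomotopy.whitneyRealization (GraphHomotopy.pathComplement (3 * d + 2)) ≃ₕ
          Metric.sphere (0 : EuclideanSpace ℝ (Fin (d + 1))) 1)) ∧
    (GraphHomotopy.IsHomotopySphere d (GraphHomotopy.pathComplement (3 * d + 3)) ∧
      Nonempty
        (GraphHomotopy.whitneyRealization (GraphHomotopy.pathComplement (3 * d + 3)) ≃ₕ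
          Metric.sphere (0 : EuclideanSpace ℝ (Fin (d + 1))) 1)) :=
  ⟨GraphHomotopy.contractible_pathComplement d,
    GraphHomotopy.isHomotopySphere_pathComplement d _ (Or.inl rfl),
    GraphHomotopy.isHomotopySphere_pathComplement d _ (Or.inr rfl)⟩
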